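/- There is an absolute constant $C>0$ with the following property. Let $\varepsilon\in(0,\tfrac12)$, let $n\ge 2$, $d$ and $k$ be natural numbers with $k\le d\le n$ and $k\ge C\varepsilon^{-2}\log^2 n$, and let $x^1,\dots,x^n\in\mathbb C^d$ be arbitrary points. Let $a_0,\dots,a_{d-1}$ be independent complex Gaussian variables, that is, $a_u=\alpha_u+i\beta_u$ with $\alpha_u,\beta_u$ independent real Gaussian variables of mean $0$ and variance $1$, and let $\varkappa_0,\dots,\varkappa_{d-1}$ be independent random signs, each equal to $+1$ or $-1$ with probability $\tfrac12$; assume that $a=(a_0,\dots,a_{d-1})$ and $\varkappa=(\varkappa_0,\dots,\varkappa_{d-1})$ are independent of each other. Let $M_{a,k}\in\mathbb C^{k\times d}$ be the partial circulant matrix with entries $(M_{a,k})_{j,u}=a_{(u-j)\bmod d}$ for $0\le j<k$, $0\le u<d$, and let $D_\varkappa=\operatorname{diag}(\varkappa_0,\dots,\varkappa_{d-1})$. Then, with probability at least $2/3$, the mapping $f:\mathbb C^d\to\mathbb C^k$, $f(x)=\frac{1}{\sqrt{2k}}M_{a,k}D_\varkappa x$, satisfies $$(1-\varepsilon)\|x^j\|_2^2\le\|f(x^j)\|_2^2\le(1+\varepsilon)\|x^j\|_2^2\qquad\text{for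 all } j\in\{1,\dots,n\},$$ where $\|\cdot\|_2$ is the $\ell_2$-norm. -/

import Mathlib

open MeasureTheory ProbabilityTheory
open scoped ENNReal

/-- `z` is a complex Gaussian variable `α + i β`: its real and imaginary parts are independent
real Gaussian variables of mean `0` and variance `1`. -/
structure IsComplexGaussian {Ω : Type*} [MeasurableSpace Ω] (z : Ω → ℂ) (P : Measure Ω) :
    Prop where
  re_law : HasLaw (fun ω => (z ω).re) (gaussianReal 0 1) P
  im_law : HasLaw (fun ω => (z ω).im) (gaussianReal 0 1) P
  indep : IndepFun (fun ω => (z ω).re) (fun ω => (z ω).im) P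

/-- The law of a random sign: the values `1` and `-1` are taken with probability `1/2` each. -/
noncomputable def signLaw : Measure ℝ :=
  (2⁻¹ : ℝ≥0∞) • Measure.dirac 1 + (2⁻¹ : ℝ≥0∞) • Measure.dirac (-1)

/-- The partial circulant matrix `M_{a,k}`, formed by the first `k` rows of the `d × d` circulant
matrix whose first row is `a`; its entry in row `j` and column `u` is `a_{(u - j) mod d}`. -/
def partialCirculant {d k : ℕ} (hkd : k ≤ d) (a : Fin d → ℂ) : Matrix (Fin k) (Fin d) ℂ :=
  (Matrix.circulant a).transpose.submatrix (Fin.castLE hkd) id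

/-- The diagonal matrix `D_ϰ`, with real diagonal `ϰ`, acting on complex vectors. -/
def signDiagonal {d : ℕ} (s : Fin d → ℝ) : Matrix (Fin d) (Fin d) ℂ :=
  Matrix.diagonal (fun u => (s u : ℂ))

/-- The mapping `f(x) = (2k)^{-1/2} M_{a,k} D_ϰ x` from `ℂ^d` to `ℂ^k`. -/
noncomputable def circulantMap {d k : ℕ} (hkd : k ≤ d) (a : Fin d → ℂ) (s : Fin d → ℝ)
    (x : EuclideanSpace ℂ (Fin d)) : EuclideanSpace ℂ (Fin k) :=
  (1 / Real.sqrt (2 * (k : ℝ))) •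
    WithLp.toLp 2 ((partialCirculant hkd a * signDiagonal s).mulVec (WithLp.ofLp x))

/-! Swap the roles of matrix and vector: with `w = ϰ x`, coordinate `j` of `M D x` is `∑ v, a v * w
(v + j)`, which is linear in the Gaussian vector `a`. For fixed signs this operator has squared real
Hilbert-Schmidt norm `2k‖x‖²`, and its squared operator norm is at most the largest `|ŵ(ψ)|²` over
the characters of the cyclic group. Each `ŵ(ψ)` is a random sign sum, so outside an event of
probability `4d exp(-L/4)` all are bounded by `|ŵ(ψ)|² ≤ L‖x‖²` (`measureReal_norm_sign_sum_sq_le`).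
Gaussian concentration (`stdGaussian_norm_sq_concentration`) then fails with probability at most `2
exp(-ε²k/(8L))`. Taking `L` of order `log n`, a union bound over the points finishes; this choice of
`L` costs the second logarithm in `k`. -/

/-! ### Concentration of Gaussian quadratic forms. -/

lemma integral_exp_mul_sq_gaussianReal {t : ℝ} (ht : t < 1 / 2) :
    ∫ x, Real.exp (t * x ^ 2) ∂(gaussianReal 0 1) = (Real.sqrt (1 - 2 * t))⁻¹ := by
  rw [integral_gaussianReal_eq_integral_smul (by norm_num)]
  have h : ∀ x : ℝ, gaussianPDFReal 0 1 x • Real.exp (t * x ^ 2)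
      = (Real.sqrt (2 * Real.pi))⁻¹ * Real.exp (-(1 / 2 - t) * x ^ 2) := by
    intro x
    simp only [gaussianPDFReal, NNReal.coe_one, smul_eq_mul, mul_one, sub_zero, mul_assoc]
    rw [← Real.exp_add]
    ring_nf
  simp_rw [h]
  rw [integral_const_mul, integral_gaussian, ← Real.sqrt_inv, ← Real.sqrt_inv, ← Real.sqrt_mul
    (by positivity)]
  congr 1
  have : (1 : ℝ) - 2 * t ≠ 0 := by linarith
  have : (1 / 2 : ℝ) - t ≠ 0 := by linarith
  have := Real.pi_ne_zero
  field_simp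

lemma integrable_exp_mul_sq_gaussianReal {t : ℝ} (ht : t < 1 / 2) :
    Integrable (fun x => Real.exp (t * x ^ 2)) (gaussianReal 0 1) := by
  -- A non-integrable function has integral `0` by convention, but the closed form is positive.
  by_contra h
  have h1 := integral_exp_mul_sq_gaussianReal ht
  rw [integral_undef h] at h1
  have : 0 < (Real.sqrt (1 - 2 * t))⁻¹ := by
    have : 0 < 1 - 2 * t := by linarith
    positivity
  linarith

/-- First-order Taylor expansion of `log (1 - 2t)`, with remainder at most `(2t)² / (1 - |2t|) ≤
8t²`, then halved. -/
lemma inv_sqrt_one_sub_le_exp {t : ℝ} (ht : |t| ≤ 1 / 4) :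
    (Real.sqrt (1 - 2 * t))⁻¹ ≤ Real.exp (t + 4 * t ^ 2) := by
  have ht' := abs_le.mp ht
  have hpos : 0 < 1 - 2 * t := by linarith
  have hs : |2 * t| < 1 := by rw [abs_mul, abs_two]; linarith
  have h := Real.abs_log_sub_add_sum_range_le hs 1
  simp only [Finset.sum_range_one, zero_add, pow_one, CharP.cast_eq_zero, div_one] at h
  have h2 : |2 * t| ^ (1 + 1) / (1 - |2 * t|) ≤ 8 * t ^ 2 := by
    have : |2 * t| ≤ 1 / 2 := by rw [abs_mul, abs_two]; linarith
    rw [div_le_iff₀ (by linarith), sq_abs]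
    nlinarith [sq_nonneg t]
  have h3 := (abs_le.mp (h.trans h2)).1
  rw [Real.sqrt_eq_rpow, ← Real.rpow_neg hpos.le, Real.rpow_def_of_pos hpos, Real.exp_le_exp]
  linarith

lemma integral_exp_sum_mul_sq_le {ι : Type*} [Fintype ι] {c : ι → ℝ} (hc : ∀ i, |c i| ≤ 1 / 4) :
    Integrable (fun x : ι → ℝ => Real.exp (∑ i, c i * x i ^ 2))
        (Measure.pi fun _ => gaussianReal 0 1) ∧
      ∫ x : ι → ℝ, Real.exp (∑ i, c i * x i ^ 2) ∂(Measure.pi fun _ => gaussianReal 0 1)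
        ≤ Real.exp (∑ i, (c i + 4 * c i ^ 2)) := by
  have hlt : ∀ i, c i < 1 / 2 := fun i => by linarith [(abs_le.mp (hc i)).2]
  simp_rw [Real.exp_sum]
  refine ⟨Integrable.fintype_prod (f := fun i x => Real.exp (c i * x ^ 2))
    fun i => integrable_exp_mul_sq_gaussianReal (hlt i), ?_⟩
  rw [integral_fintype_prod_eq_prod (f := fun i x => Real.exp (c i * x ^ 2))]
  refine Finset.prod_le_prod (fun i _ => integral_nonneg fun x => (Real.exp_pos _).le) fun i _ => ?_
  rw [integral_exp_mul_sq_gaussianReal (hlt i)]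
  exact inv_sqrt_one_sub_le_exp (hc i)

/-- Exponential tail bound for a diagonal quadratic form in independent standard Gaussians; the
sign of `θ` selects the upper or the lower tail. -/
lemma measureReal_pi_gaussian_quadratic_le {ι : Type*} [Fintype ι] {l : ι → ℝ} {Λ θ r : ℝ}
    (hl0 : ∀ i, 0 ≤ l i) (hl : ∀ i, l i ≤ Λ) (hθ : |θ| * Λ ≤ 1 / 4) :
    (Measure.pi fun _ : ι => gaussianReal 0 1).real
        {x | r ≤ θ * (∑ i, l i * x i ^ 2 - ∑ i, l i)}
      ≤ Real.exp (-r + 4 * θ ^ 2 * Λ * ∑ i, l i) := by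
  obtain ⟨hint, hle⟩ := integral_exp_sum_mul_sq_le (c := fun i => θ * l i) fun i => by
    rw [abs_mul, abs_of_nonneg (hl0 i)]
    exact (mul_le_mul_of_nonneg_left (hl i) (abs_nonneg θ)).trans hθ
  set μ := Measure.pi fun _ : ι => gaussianReal 0 1
  have h1 := measure_ge_le_exp_mul_mgf (μ := μ) (X := fun x : ι → ℝ => ∑ i, θ * l i * x i ^ 2)
    (t := 1) (r + θ * ∑ i, l i) zero_le_one (by simpa using hint)
  have hset : {x : ι → ℝ | r ≤ θ * (∑ i, l i * x i ^ 2 - ∑ i, l i)}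
      = {x : ι → ℝ | r + θ * ∑ i, l i ≤ ∑ i, θ * l i * x i ^ 2} := by
    ext x
    simp only [Set.mem_ofPred_eq, mul_assoc, ← Finset.mul_sum]
    constructor <;> intro h <;> linarith
  rw [hset]
  refine h1.trans ?_
  simp only [mgf, one_mul]
  refine (mul_le_mul_of_nonneg_left hle (Real.exp_pos _).le).trans ?_
  rw [← Real.exp_add, Real.exp_le_exp, Finset.sum_add_distrib, ← Finset.mul_sum]
  have : ∑ i, 4 * (θ * l i) ^ 2 ≤ 4 * θ ^ 2 * Λ * ∑ i, l i := by
    rw [Finset.mul_sum]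
    refine Finset.sum_le_sum fun i _ => ?_
    have : l i * l i ≤ Λ * l i := mul_le_mul_of_nonneg_right (hl i) (hl0 i)
    nlinarith [mul_le_mul_of_nonneg_left this (sq_nonneg θ)]
  linarith

lemma measureReal_pi_gaussian_quadratic_abs_le {ι : Type*} [Fintype ι] {l : ι → ℝ} {Λ ε : ℝ}
    (hl0 : ∀ i, 0 ≤ l i) (hl : ∀ i, l i ≤ Λ) (hΛ : 0 < Λ) (hε : 0 < ε) (hε1 : ε ≤ 1) :
    (Measure.pi fun _ : ι => gaussianReal 0 1).real
        {x | ε * ∑ i, l i ≤ |∑ i, l i * x i ^ 2 - ∑ i, l i|}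
      ≤ 2 * Real.exp (-(ε ^ 2 * (∑ i, l i) / (16 * Λ))) := by
  set T := ∑ i, l i
  -- This `θ` minimizes the exponent `-θεT + 4θ²ΛT`; `ε ≤ 1` keeps it in the admissible range.
  set θ := ε / (8 * Λ) with hθdef
  have hθ : 0 < θ := by positivity
  have hb : |θ| * Λ ≤ 1 / 4 := by
    rw [abs_of_pos hθ, hθdef]
    field_simp
    linarith
  have hexp : -(θ * (ε * T)) + 4 * θ ^ 2 * Λ * T = -(ε ^ 2 * T / (16 * Λ)) := by
    rw [hθdef]
    field_simp
    ring
  have h1 := measureReal_pi_gaussian_quadratic_le (r := θ * (ε * T)) hl0 hl hb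
  have h2 := measureReal_pi_gaussian_quadratic_le (θ := -θ) (r := θ * (ε * T)) hl0 hl
    (by rwa [abs_neg])
  rw [neg_sq, hexp] at h2
  rw [hexp] at h1
  rw [two_mul]
  refine (measureReal_mono ?_).trans ((measureReal_union_le _ _).trans (add_le_add h1 h2))
  intro x hx
  simp only [Set.mem_ofPred_eq, Set.mem_union] at hx ⊢
  rcases le_abs.mp hx with h | h
  · exact Or.inl (mul_le_mul_of_nonneg_left h hθ.le)
  · right
    rw [neg_mul, ← mul_neg]
    exact mul_le_mul_of_nonneg_left h hθ.le

/-- Concentration of `‖A v‖²` for a standard Gaussian vector `v` around the squared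
Hilbert-Schmidt norm of `A`. -/
theorem stdGaussian_norm_sq_concentration {E F κ : Type*} [NormedAddCommGroup E]
    [InnerProductSpace ℝ E] [FiniteDimensional ℝ E] [MeasurableSpace E] [BorelSpace E]
    [NormedAddCommGroup F] [InnerProductSpace ℝ F] [FiniteDimensional ℝ F] [Fintype κ]
    (A : E →ₗ[ℝ] F) (b : OrthonormalBasis κ ℝ E) {Λ ε : ℝ} (hΛ : 0 < Λ)
    (hA : ∀ v, ‖A v‖ ^ 2 ≤ Λ * ‖v‖ ^ 2) (hε : 0 < ε) (hε1 : ε ≤ 1) :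
    (stdGaussian E).real {v | ε * ∑ i, ‖A (b i)‖ ^ 2 ≤ |‖A v‖ ^ 2 - ∑ i, ‖A (b i)‖ ^ 2|}
      ≤ 2 * Real.exp (-(ε ^ 2 * (∑ i, ‖A (b i)‖ ^ 2) / (16 * Λ))) := by
  -- In an eigenbasis of `A*A` the form is diagonal, the Gaussian coordinates stay independent, and
  -- the trace equals the sum over `b`.
  set S : E →ₗ[ℝ] E := LinearMap.adjoint A ∘ₗ A with hS
  have hinner : ∀ v w, inner ℝ v (S w) = inner ℝ (A v) (A w) := fun v w => by
    simp [hS, LinearMap.adjoint_inner_right]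
  have hsymm : S.IsSymmetric := fun v w => by
    rw [hinner, real_inner_comm, hinner, real_inner_comm]
  set e := hsymm.eigenvectorBasis rfl
  set l := hsymm.eigenvalues rfl
  have hAe : ∀ i j, inner ℝ (A (e i)) (A (e j)) = if i = j then l j else 0 := fun i j => by
    rw [← hinner, hsymm.apply_eigenvectorBasis, inner_smul_right,
      orthonormal_iff_ite.mp e.orthonormal]
    simp [l]
  have hl : ∀ i, ‖A (e i)‖ ^ 2 = l i := fun i => by
    rw [← real_inner_self_eq_norm_sq, hAe, if_pos rfl]
  have htrace : ∑ i, ‖A (b i)‖ ^ 2 = ∑ i, l i := by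
    simp_rw [← hl, ← real_inner_self_eq_norm_sq, ← hinner]
    rw [← LinearMap.trace_eq_sum_inner, ← LinearMap.trace_eq_sum_inner]
  have hquad : ∀ x : Fin (Module.finrank ℝ E) → ℝ,
      ‖A (∑ i, x i • e i)‖ ^ 2 = ∑ i, l i * x i ^ 2 := fun x => by
    rw [← real_inner_self_eq_norm_sq, map_sum, sum_inner]
    refine Finset.sum_congr rfl fun i _ => ?_
    simp only [map_smul, inner_sum, inner_smul_left, inner_smul_right, hAe]
    simp
    ring
  have hmeas : MeasurableSet
      {v | ε * ∑ i, ‖A (b i)‖ ^ 2 ≤ |‖A v‖ ^ 2 - ∑ i, ‖A (b i)‖ ^ 2|} := by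
    have : Continuous A := A.continuous_of_finiteDimensional
    exact (isClosed_le (by fun_prop) (by fun_prop)).measurableSet
  rw [stdGaussian_eq_map_pi_orthonormalBasis e, map_measureReal_apply (by fun_prop) hmeas]
  simp only [Set.preimage_ofPred_eq, hquad, htrace]
  refine measureReal_pi_gaussian_quadratic_abs_le (fun i => ?_) (fun i => ?_) hΛ hε hε1
  · rw [← hl]; positivity
  · rw [← hl]
    simpa using hA (e i)

/-! ### Fourier analysis on finite abelian groups. -/

/-- Parseval's identity, from orthogonality of characters. -/
lemma AddChar.sum_norm_sq_sum_mul {G : Type*} [AddCommGroup G] [Fintype G] (f : G → ℂ) :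
    ∑ ψ : AddChar G ℂ, ‖∑ u, f u * ψ u‖ ^ 2 = Fintype.card G * ∑ u, ‖f u‖ ^ 2 := by
  classical
  have h : ∀ ψ : AddChar G ℂ, ((‖∑ u, f u * ψ u‖ ^ 2 : ℝ) : ℂ)
      = ∑ u, ∑ v, f u * (starRingEnd ℂ) (f v) * ψ (u - v) := fun ψ => by
    rw [Complex.ofReal_pow, ← Complex.mul_conj', map_sum, Finset.sum_mul_sum]
    refine Finset.sum_congr rfl fun u _ => Finset.sum_congr rfl fun v _ => ?_
    rw [map_mul, ← AddChar.map_neg_eq_conj, sub_eq_add_neg, AddChar.map_add_eq_mul]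
    ring
  have hc : ((∑ ψ : AddChar G ℂ, ‖∑ u, f u * ψ u‖ ^ 2 : ℝ) : ℂ)
      = ((Fintype.card G * ∑ u, ‖f u‖ ^ 2 : ℝ) : ℂ) := by
    rw [Complex.ofReal_sum, Finset.sum_congr rfl fun ψ _ => h ψ, Finset.sum_comm]
    push_cast
    rw [Finset.mul_sum]
    refine Finset.sum_congr rfl fun u _ => ?_
    rw [Finset.sum_comm]
    simp only [← Finset.mul_sum]
    simp only [AddChar.sum_apply_eq_ite]
    simp [sub_eq_zero, Complex.mul_conj', mul_comm]
  exact_mod_cast hc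

/-- The norm of a correlation operator on a finite abelian group is at most the largest modulus of
the Fourier coefficients of its kernel. -/
lemma sum_norm_sq_correlation_le {G : Type*} [AddCommGroup G] [Fintype G]
    {w : G → ℂ} {L : ℝ} (hw : ∀ ψ : AddChar G ℂ, ‖∑ u, w u * ψ u‖ ^ 2 ≤ L) (b : G → ℂ) :
    ∑ j, ‖∑ v, b v * w (v + j)‖ ^ 2 ≤ L * ∑ v, ‖b v‖ ^ 2 := by
  classical
  have hcard : (0 : ℝ) < Fintype.card G := by exact_mod_cast Fintype.card_pos
  -- The Fourier transform turns the correlation into a product; Parseval is then applied on both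
  -- sides.
  have hfact : ∀ ψ : AddChar G ℂ, ∑ j, (∑ v, b v * w (v + j)) * ψ j
      = (∑ v, b (-v) * ψ v) * ∑ u, w u * ψ u := fun ψ => by
    rw [← Equiv.sum_comp (Equiv.neg G) fun v => b (-v) * ψ v, Finset.sum_mul]
    simp_rw [Finset.sum_mul]
    rw [Finset.sum_comm]
    refine Finset.sum_congr rfl fun v _ => ?_
    rw [← Equiv.sum_comp (Equiv.addLeft v) fun u => w u * ψ u, Finset.mul_sum]
    refine Finset.sum_congr rfl fun j _ => ?_
    have : ψ (-v) * ψ v = 1 := by rw [← AddChar.map_add_eq_mul]; simp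
    simp only [Equiv.neg_apply, neg_neg, Equiv.coe_addLeft, AddChar.map_add_eq_mul]
    linear_combination (-b v * w (v + j) * ψ j) * this
  refine le_of_mul_le_mul_left ?_ hcard
  rw [← AddChar.sum_norm_sq_sum_mul]
  simp_rw [hfact, norm_mul, mul_pow]
  calc _ ≤ ∑ ψ : AddChar G ℂ, ‖∑ v, b (-v) * ψ v‖ ^ 2 * L :=
        Finset.sum_le_sum fun ψ _ => mul_le_mul_of_nonneg_left (hw ψ) (by positivity)
    _ = _ := by
        rw [← Finset.sum_mul, AddChar.sum_norm_sq_sum_mul fun v => b (-v),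
          ← Equiv.sum_comp (Equiv.neg G) fun v => ‖b (-v)‖ ^ 2]
        simp only [Equiv.neg_apply, neg_neg]
        ring

/-! ### Tail bounds for random sign sums. -/

instance isProbabilityMeasure_signLaw : IsProbabilityMeasure signLaw :=
  ⟨by simp [signLaw, ENNReal.inv_two_add_inv_two]⟩

lemma hasSubgaussianMGF_of_hasLaw_signLaw {Ω : Type*} [MeasurableSpace Ω] {P : Measure Ω}
    {X : Ω → ℝ} (hX : HasLaw X signLaw P) : HasSubgaussianMGF X 1 P := by
  have := hX.isProbabilityMeasure
  have hmem : ∀ᵐ ω ∂P, X ω ∈ Set.Icc (-1 : ℝ) 1 := by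
    rw [hX.ae_iff (p := fun x => x ∈ Set.Icc (-1 : ℝ) 1)
      (measurableSet_Icc (a := (-1 : ℝ)) (b := 1)).mem, signLaw, ae_add_measure_iff]
    constructor <;> refine Measure.ae_smul_measure ?_ _ <;>
      exact (ae_dirac_iff (p := fun x => x ∈ Set.Icc (-1 : ℝ) 1) measurableSet_Icc).2
        (by norm_num)
  have hint : P[X] = 0 := by
    rw [hX.integral_eq, signLaw, integral_add_measure, integral_smul_measure,
      integral_smul_measure, integral_dirac, integral_dirac]
    · simp
    · exact (integrable_dirac (by simp)).smul_measure (by simp)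
    · exact (integrable_dirac (by simp)).smul_measure (by simp)
  convert hasSubgaussianMGF_of_mem_Icc_of_integral_eq_zero hX.aemeasurable hmem hint
  ext
  norm_num

lemma measureReal_sign_sum_abs_le {Ω ι : Type*} [MeasurableSpace Ω] [Fintype ι] {P : Measure Ω}
    [IsProbabilityMeasure P] {s : ι → Ω → ℝ} (hs : ∀ u, HasLaw (s u) signLaw P)
    (hind : iIndepFun s P) (c : ι → ℝ) {σ t : ℝ} (hc : ∑ u, c u ^ 2 ≤ σ) (hσ : 0 < σ)
    (ht : 0 ≤ t) :
    P.real {ω | t ≤ |∑ u, s u ω * c u|} ≤ 2 * Real.exp (-t ^ 2 / (2 * σ)) := by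
  have key : ∀ c : ι → ℝ, ∑ u, c u ^ 2 ≤ σ →
      P.real {ω | t ≤ ∑ u, s u ω * c u} ≤ Real.exp (-t ^ 2 / (2 * σ)) := by
    intro c hc
    have hsub : ∀ u ∈ Finset.univ,
        HasSubgaussianMGF (fun ω => s u ω * c u) (⟨c u ^ 2, sq_nonneg _⟩ * 1 : NNReal) P :=
      fun u _ => by
      simpa only [mul_comm] using (hasSubgaussianMGF_of_hasLaw_signLaw (hs u)).const_mul (c u)
    have hind' : iIndepFun (fun u ω => s u ω * c u) P :=
      hind.comp (fun u x => x * c u) fun u => by fun_prop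
    have hsum := HasSubgaussianMGF.sum_of_iIndepFun hind' hsub
    -- Enlarging the variance proxy to `σ` lets real and imaginary parts share one bound.
    have hle : HasSubgaussianMGF (fun ω => ∑ u, s u ω * c u) ⟨σ, hσ.le⟩ P := by
      refine ⟨hsum.integrable_exp_mul, fun r => (hsum.mgf_le r).trans ?_⟩
      rw [Real.exp_le_exp]
      have : ((∑ u, (⟨c u ^ 2, sq_nonneg _⟩ * 1 : NNReal) : NNReal) : ℝ) ≤ σ := by
        rw [NNReal.coe_sum]
        refine le_of_eq_of_le (Finset.sum_congr rfl fun u _ => ?_) hc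
        exact mul_one (c u ^ 2)
      gcongr
      exact this
    exact hle.measure_ge_le ht
  rw [two_mul]
  refine (measureReal_mono ?_).trans ((measureReal_union_le _ _).trans
    (add_le_add (key c hc) (key (fun u => -c u) (by simpa using hc))))
  intro ω hω
  simpa [le_abs] using hω

/-- If `|z|² > Lσ`, then the real or the imaginary part has square at least `Lσ/2`. -/
lemma measureReal_norm_sign_sum_sq_le {Ω ι : Type*} [MeasurableSpace Ω] [Fintype ι]
    {P : Measure Ω} [IsProbabilityMeasure P] {s : ι → Ω → ℝ} (hs : ∀ u, HasLaw (s u) signLaw P)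
    (hind : iIndepFun s P) (c : ι → ℂ) {σ L : ℝ} (hc : ∑ u, ‖c u‖ ^ 2 = σ) (hσ : 0 < σ)
    (hL : 0 ≤ L) :
    P.real {ω | L * σ < ‖∑ u, (s u ω : ℂ) * c u‖ ^ 2} ≤ 4 * Real.exp (-(L / 4)) := by
  have ht : 0 ≤ L * σ / 2 := by positivity
  have hexp : -√(L * σ / 2) ^ 2 / (2 * σ) = -(L / 4) := by
    rw [Real.sq_sqrt ht]
    field_simp
    norm_num
  have hre := measureReal_sign_sum_abs_le hs hind (fun u => (c u).re) (σ := σ)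
    (t := √(L * σ / 2)) (hc ▸ Finset.sum_le_sum fun u _ => by
      rw [← Complex.normSq_eq_norm_sq, Complex.normSq_apply]; nlinarith [sq_nonneg (c u).im])
    hσ (Real.sqrt_nonneg _)
  have him := measureReal_sign_sum_abs_le hs hind (fun u => (c u).im) (σ := σ)
    (t := √(L * σ / 2)) (hc ▸ Finset.sum_le_sum fun u _ => by
      rw [← Complex.normSq_eq_norm_sq, Complex.normSq_apply]; nlinarith [sq_nonneg (c u).re])
    hσ (Real.sqrt_nonneg _)
  rw [hexp] at hre him
  have h4 : 4 * Real.exp (-(L / 4)) = 2 * Real.exp (-(L / 4)) + 2 * Real.exp (-(L / 4)) := by ring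
  rw [h4]
  refine (measureReal_mono ?_).trans ((measureReal_union_le _ _).trans (add_le_add hre him))
  intro ω hω
  simp only [Set.mem_ofPred_eq, Set.mem_union, Real.sqrt_le_left (abs_nonneg _),
    sq_abs] at hω ⊢
  by_contra! h
  rw [← Complex.normSq_eq_norm_sq, Complex.normSq_apply] at hω
  simp only [Complex.re_sum, Complex.im_sum, Complex.re_ofReal_mul, Complex.im_ofReal_mul] at hω
  linarith [h.1, h.2]

/-! ### Complex Gaussian vectors as standard Gaussians on a real space. -/

lemma IsComplexGaussian.hasLaw {Ω : Type*} [MeasurableSpace Ω] {P : Measure Ω} {z : Ω → ℂ}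
    (hz : IsComplexGaussian z P) : HasLaw z (stdGaussian ℂ) P := by
  have := hz.re_law.isProbabilityMeasure
  have hjoint := hz.indep.hasLaw_prod hz.re_law hz.im_law
  have hmeas : Measurable fun p : ℝ × ℝ => (p.1 : ℂ) + p.2 * Complex.I := by fun_prop
  have hlaw : HasLaw (fun p : ℝ × ℝ => (p.1 : ℂ) + p.2 * Complex.I) (stdGaussian ℂ)
      ((gaussianReal 0 1).prod (gaussianReal 0 1)) := by
    refine ⟨hmeas.aemeasurable, ?_⟩
    have := Measure.isProbabilityMeasure_map (μ := (gaussianReal 0 1).prod (gaussianReal 0 1))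
      hmeas.aemeasurable
    refine Measure.ext_of_charFun (funext fun t => ?_)
    rw [charFun_stdGaussian, charFun_apply, integral_map hmeas.aemeasurable (by fun_prop)]
    have h : ∀ p : ℝ × ℝ,
        Complex.exp ((inner ℝ ((p.1 : ℂ) + p.2 * Complex.I) t : ℝ) * Complex.I)
          = Complex.exp (t.re * p.1 * Complex.I) * Complex.exp (t.im * p.2 * Complex.I) := by
      intro p
      rw [← Complex.exp_add, Complex.inner]
      congr 1
      simp
      ring
    simp_rw [h]
    rw [integral_prod_mul (fun x : ℝ => Complex.exp (t.re * x * Complex.I))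
      (fun y : ℝ => Complex.exp (t.im * y * Complex.I)), ← charFun_apply_real,
      ← charFun_apply_real, charFun_gaussianReal, charFun_gaussianReal, ← Complex.exp_add,
      ← Complex.ofReal_pow ‖t‖, ← Complex.normSq_eq_norm_sq, Complex.normSq_apply]
    congr 1
    push_cast
    simp
    ring
  simpa only [Complex.re_add_im] using hlaw.fun_comp hjoint

lemma hasLaw_toLp_stdGaussian {Ω ι : Type*} [MeasurableSpace Ω] [Fintype ι] {P : Measure Ω}
    {a : ι → Ω → ℂ} (ha : ∀ u, IsComplexGaussian (a u) P) (hind : iIndepFun a P) :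
    HasLaw (fun ω => WithLp.toLp 2 fun u => a u ω) (stdGaussian (EuclideanSpace ℂ ι)) P := by
  have hpi := hind.hasLaw_pi fun u => (ha u).hasLaw
  have hlaw : HasLaw (WithLp.toLp 2) (stdGaussian (EuclideanSpace ℂ ι))
      (Measure.pi fun _ : ι => stdGaussian ℂ) := by
    have hmeas : Measurable (WithLp.toLp 2 : (ι → ℂ) → EuclideanSpace ℂ ι) := by fun_prop
    refine ⟨hmeas.aemeasurable, ?_⟩
    have := Measure.isProbabilityMeasure_map (μ := Measure.pi fun _ : ι => stdGaussian ℂ)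
      hmeas.aemeasurable
    refine Measure.ext_of_charFun (funext fun t => ?_)
    rw [charFun_pi, charFun_stdGaussian]
    simp_rw [charFun_stdGaussian]
    rw [← Complex.exp_sum, ← Complex.ofReal_pow, EuclideanSpace.norm_sq_eq]
    push_cast
    rw [← Finset.sum_div, Finset.sum_neg_distrib]
  exact hlaw.comp hpi

/-! ### Concentration for a fixed kernel. -/

/-- The correlation operator with kernel `w`, restricted to the output coordinates `e j`. -/
def partialCorrelation {G κ : Type*} [AddCommGroup G] [Fintype G] (e : κ → G) (w : G → ℂ) :
    EuclideanSpace ℂ G →ₗ[ℝ] EuclideanSpace ℂ κ where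
  toFun a := WithLp.toLp 2 fun j => ∑ v, a v * w (v + e j)
  map_add' a b := by
    ext j
    simp [add_mul, Finset.sum_add_distrib]
  map_smul' r a := by
    ext j
    simp [Finset.mul_sum, mul_assoc]

section partialCorrelation

variable {G κ : Type*} [AddCommGroup G] [Fintype G] [Fintype κ] {e : κ → G} {w : G → ℂ}

lemma norm_sq_partialCorrelation (a : EuclideanSpace ℂ G) :
    ‖partialCorrelation e w a‖ ^ 2 = ∑ j, ‖∑ v, a v * w (v + e j)‖ ^ 2 :=
  EuclideanSpace.norm_sq_eq _

lemma norm_sq_partialCorrelation_le (he : Function.Injective e) {Λ : ℝ}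
    (hw : ∀ ψ : AddChar G ℂ, ‖∑ u, w u * ψ u‖ ^ 2 ≤ Λ) (a : EuclideanSpace ℂ G) :
    ‖partialCorrelation e w a‖ ^ 2 ≤ Λ * ‖a‖ ^ 2 := by
  classical
  rw [norm_sq_partialCorrelation, EuclideanSpace.norm_sq_eq]
  refine le_trans ?_ (sum_norm_sq_correlation_le hw a)
  rw [← Finset.sum_image (s := Finset.univ) (g := e)
    (f := fun i => ‖∑ v, a v * w (v + i)‖ ^ 2) he.injOn]
  exact Finset.sum_le_sum_of_subset_of_nonneg (Finset.subset_univ _) fun _ _ _ => by positivity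

/-- The factor `2` arises because each complex coordinate contributes the two real directions `1`
and `I`. -/
lemma sum_norm_sq_partialCorrelation_basis :
    ∑ p, ‖partialCorrelation e w
        (Pi.orthonormalBasis (fun _ : G => Complex.orthonormalBasisOneI) p)‖ ^ 2
      = 2 * Fintype.card κ * ∑ u, ‖w u‖ ^ 2 := by
  classical
  have h : ∀ (u : G) (i : Fin 2), ‖partialCorrelation e w
      (Pi.orthonormalBasis (fun _ : G => Complex.orthonormalBasisOneI) ⟨u, i⟩)‖ ^ 2
        = ∑ j, ‖w (u + e j)‖ ^ 2 := fun u i => by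
    rw [norm_sq_partialCorrelation]
    refine Finset.sum_congr rfl fun j _ => ?_
    rw [Finset.sum_eq_single u]
    · rw [norm_mul]
      fin_cases i <;> simp
    · intro v _ hv
      simp [hv]
    · simp
  rw [Fintype.sum_sigma]
  simp_rw [h]
  rw [Finset.sum_comm]
  simp_rw [Finset.sum_comm (s := (Finset.univ : Finset G)) (t := (Finset.univ : Finset κ))]
  have h2 : ∀ j, ∑ u, ‖w (u + e j)‖ ^ 2 = ∑ u, ‖w u‖ ^ 2 := fun j =>
    Equiv.sum_comp (Equiv.addRight (e j)) fun u => ‖w u‖ ^ 2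
  simp only [h2, Finset.sum_const, Finset.card_univ, Fintype.card_fin, nsmul_eq_mul]
  push_cast
  ring

lemma stdGaussian_partialCorrelation_concentration (he : Function.Injective e) {L ε σ : ℝ}
    (hσ : ∑ u, ‖w u‖ ^ 2 = σ) (hσ0 : 0 < σ) (hL : 0 < L)
    (hw : ∀ ψ : AddChar G ℂ, ‖∑ u, w u * ψ u‖ ^ 2 ≤ L * σ) (hε : 0 < ε) (hε1 : ε ≤ 1) :
    (stdGaussian (EuclideanSpace ℂ G)).real
        {a | ε * (2 * Fintype.card κ * σ)
          ≤ |∑ j, ‖∑ v, a v * w (v + e j)‖ ^ 2 - 2 * Fintype.card κ * σ|}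
      ≤ 2 * Real.exp (-(ε ^ 2 * Fintype.card κ / (8 * L))) := by
  have h := stdGaussian_norm_sq_concentration (partialCorrelation e w)
    (Pi.orthonormalBasis fun _ : G => Complex.orthonormalBasisOneI) (mul_pos hL hσ0)
    (norm_sq_partialCorrelation_le he hw) hε hε1
  rw [sum_norm_sq_partialCorrelation_basis, hσ] at h
  simp only [norm_sq_partialCorrelation] at h
  convert h using 4
  field_simp
  ring

end partialCorrelation

/-! ### Conditioning on the signs. -/

lemma measureReal_prodMk_le_of_forall_section {Ω E S : Type*} [MeasurableSpace Ω]
    [MeasurableSpace E] [MeasurableSpace S] {P : Measure Ω} [IsProbabilityMeasure P]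
    {μ : Measure E} {X : Ω → E} {Y : Ω → S} (hX : HasLaw X μ P) (hY : AEMeasurable Y P)
    (hXY : IndepFun X Y P) {H : Set (E × S)} (hH : MeasurableSet H) {p : ℝ} (hp : 0 ≤ p)
    (h : ∀ y, μ.real {x | (x, y) ∈ H} ≤ p) :
    P.real {ω | (X ω, Y ω) ∈ H} ≤ p := by
  have hμ : IsProbabilityMeasure μ := hX.isProbabilityMeasure_iff.1 inferInstance
  have hν : IsProbabilityMeasure (P.map Y) := Measure.isProbabilityMeasure_map hY
  have hjoint := hXY.hasLaw_prod hX (⟨hY, rfl⟩ : HasLaw Y (P.map Y) P)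
  rw [hjoint.measureReal_eq (p := fun z => z ∈ H) hH]
  refine ENNReal.toReal_le_of_le_ofReal hp ?_
  change (μ.prod (P.map Y)) H ≤ _
  rw [Measure.prod_apply_symm hH]
  calc ∫⁻ y, μ ((fun x => (x, y)) ⁻¹' H) ∂(P.map Y)
      ≤ ∫⁻ _, ENNReal.ofReal p ∂(P.map Y) :=
        lintegral_mono fun y => (ENNReal.le_ofReal_iff_toReal_le (measure_ne_top _ _) hp).2 (h y)
    _ = ENNReal.ofReal p := by simp

lemma ae_sq_eq_one_of_hasLaw_signLaw {Ω : Type*} [MeasurableSpace Ω] {P : Measure Ω}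
    {X : Ω → ℝ} (hX : HasLaw X signLaw P) : ∀ᵐ ω ∂P, X ω ^ 2 = 1 := by
  have hm : MeasurableSet {x : ℝ | x ^ 2 = 1} :=
    (isClosed_eq (by fun_prop) (by fun_prop)).measurableSet
  rw [hX.ae_iff (p := fun x => x ^ 2 = 1) hm.mem, signLaw, ae_add_measure_iff]
  constructor <;> refine Measure.ae_smul_measure ?_ _ <;>
    exact (ae_dirac_iff (p := fun x : ℝ => x ^ 2 = 1) hm).2 (by norm_num)

/-- For a single nonzero vector: failure probability of the randomized correlation operator. -/
lemma measureReal_randomized_correlation_le {Ω G κ : Type*} [MeasurableSpace Ω] [AddCommGroup G]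
    [Fintype G] [Fintype κ] {P : Measure Ω} [IsProbabilityMeasure P] {a : G → Ω → ℂ}
    {s : G → Ω → ℝ} (ha : ∀ u, IsComplexGaussian (a u) P) (haind : iIndepFun a P)
    (hs : ∀ u, HasLaw (s u) signLaw P) (hsind : iIndepFun s P)
    (has : IndepFun (fun ω u => a u ω) (fun ω u => s u ω) P) {e : κ → G}
    (he : Function.Injective e) (x : G → ℂ) {L ε σ : ℝ} (hσ : ∑ u, ‖x u‖ ^ 2 = σ) (hσ0 : 0 < σ)
    (hL : 0 < L) (hε : 0 < ε) (hε1 : ε ≤ 1) :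
    P.real {ω | ε * (2 * Fintype.card κ * σ)
        ≤ |∑ j, ‖∑ v, a v ω * (s (v + e j) ω * x (v + e j))‖ ^ 2 - 2 * Fintype.card κ * σ|}
      ≤ Fintype.card G * (4 * Real.exp (-(L / 4)))
        + 2 * Real.exp (-(ε ^ 2 * Fintype.card κ / (8 * L))) := by
  -- Failure together with good signs: for bad signs the section is empty, so the Gaussian bound
  -- holds on every section.
  set H : Set (EuclideanSpace ℂ G × (G → ℝ)) :=
    {z | (∀ u, z.2 u ^ 2 = 1) ∧ (∀ ψ : AddChar G ℂ, ‖∑ u, z.2 u * x u * ψ u‖ ^ 2 ≤ L * σ) ∧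
      ε * (2 * Fintype.card κ * σ) ≤
        |∑ j, ‖∑ v, z.1 v * (z.2 (v + e j) * x (v + e j))‖ ^ 2 - 2 * Fintype.card κ * σ|}
  have hH : MeasurableSet H := by
    have h1 : IsClosed {z : EuclideanSpace ℂ G × (G → ℝ) | ∀ u, z.2 u ^ 2 = 1} := by
      simp only [Set.ofPred_forall]
      exact isClosed_iInter fun u => isClosed_eq (by fun_prop) (by fun_prop)
    have h2 : IsClosed {z : EuclideanSpace ℂ G × (G → ℝ) |
        ∀ ψ : AddChar G ℂ, ‖∑ u, z.2 u * x u * ψ u‖ ^ 2 ≤ L * σ} := by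
      simp only [Set.ofPred_forall]
      exact isClosed_iInter fun u => isClosed_le (by fun_prop) (by fun_prop)
    have h3 : IsClosed {z : EuclideanSpace ℂ G × (G → ℝ) | ε * (2 * Fintype.card κ * σ) ≤
        |∑ j, ‖∑ v, z.1 v * (z.2 (v + e j) * x (v + e j))‖ ^ 2 - 2 * Fintype.card κ * σ|} :=
      isClosed_le (by fun_prop) (by fun_prop)
    exact (h1.inter (h2.inter h3)).measurableSet
  have hgauss : P.real {ω | (WithLp.toLp 2 fun u => a u ω, fun u => s u ω) ∈ H}
      ≤ 2 * Real.exp (-(ε ^ 2 * Fintype.card κ / (8 * L))) := by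
    refine measureReal_prodMk_le_of_forall_section (hasLaw_toLp_stdGaussian ha haind)
      (aemeasurable_pi_lambda _ fun u => (hs u).aemeasurable)
      (has.comp (φ := WithLp.toLp 2) (ψ := id) (by fun_prop) measurable_id) hH (by positivity)
      fun t => ?_
    by_cases ht : (∀ u, t u ^ 2 = 1) ∧
        ∀ ψ : AddChar G ℂ, ‖∑ u, t u * x u * ψ u‖ ^ 2 ≤ L * σ
    · have hσ' : ∑ u, ‖(t u : ℂ) * x u‖ ^ 2 = σ := by
        simp_rw [norm_mul, mul_pow, Complex.norm_real, Real.norm_eq_abs, sq_abs, ht.1, one_mul]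
        exact hσ
      refine (measureReal_mono ?_).trans (stdGaussian_partialCorrelation_concentration he
        (w := fun u => t u * x u) hσ' hσ0 hL ht.2 hε hε1)
      exact fun b hb => hb.2.2
    · have : {b : EuclideanSpace ℂ G | (b, t) ∈ H} = ∅ :=
        Set.eq_empty_of_forall_notMem fun b hb => ht ⟨hb.1, hb.2.1⟩
      rw [this, measureReal_empty]
      positivity
  have hsign : P.real (⋃ ψ : AddChar G ℂ,
      {ω | L * σ < ‖∑ u, (s u ω : ℂ) * (x u * ψ u)‖ ^ 2})
        ≤ Fintype.card G * (4 * Real.exp (-(L / 4))) := by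
    refine (measureReal_iUnion_fintype_le _).trans ?_
    refine (Finset.sum_le_sum fun ψ _ => measureReal_norm_sign_sum_sq_le hs hsind
      (fun u => x u * ψ u) (σ := σ) (by simpa using hσ) hσ0 hL.le).trans ?_
    simp [AddChar.card_eq]
  have hone : P.real {ω | ¬ ∀ u, s u ω ^ 2 = 1} = 0 := by
    rw [measureReal_eq_zero_iff]
    exact ae_iff.1 (ae_all_iff.2 fun u => ae_sq_eq_one_of_hasLaw_signLaw (hs u))
  have hsub : {ω | ε * (2 * Fintype.card κ * σ)
        ≤ |∑ j, ‖∑ v, a v ω * (s (v + e j) ω * x (v + e j))‖ ^ 2 - 2 * Fintype.card κ * σ|}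
      ⊆ {ω | ¬ ∀ u, s u ω ^ 2 = 1} ∪ ((⋃ ψ : AddChar G ℂ,
        {ω | L * σ < ‖∑ u, (s u ω : ℂ) * (x u * ψ u)‖ ^ 2}) ∪
        {ω | (WithLp.toLp 2 fun u => a u ω, fun u => s u ω) ∈ H}) := by
    intro ω hω
    by_cases h1 : ∀ u, s u ω ^ 2 = 1
    · right
      by_cases h2 : ∀ ψ : AddChar G ℂ, ‖∑ u, s u ω * x u * ψ u‖ ^ 2 ≤ L * σ
      · exact Or.inr ⟨h1, h2, hω⟩
      · left
        push Not at h2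
        simpa only [Set.mem_iUnion, Set.mem_ofPred_eq, mul_assoc] using h2
    · exact Or.inl h1
  refine (measureReal_mono hsub).trans ((measureReal_union_le _ _).trans ?_)
  rw [hone, zero_add]
  exact (measureReal_union_le _ _).trans (add_le_add hsign hgauss)

/-! ### The circulant map, constants and union bound. -/

lemma norm_sq_circulantMap {d k : ℕ} [NeZero d] (hkd : k ≤ d) (a : Fin d → ℂ) (s : Fin d → ℝ)
    (x : EuclideanSpace ℂ (Fin d)) :
    ‖circulantMap hkd a s x‖ ^ 2 = (2 * (k : ℝ))⁻¹ * ∑ j : Fin k,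
      ‖∑ v, a v * (s (v + Fin.castLE hkd j) * x (v + Fin.castLE hkd j))‖ ^ 2 := by
  rw [circulantMap, norm_smul, mul_pow, Real.norm_eq_abs, sq_abs, div_pow, one_pow,
    Real.sq_sqrt (by positivity), one_div, EuclideanSpace.norm_sq_eq]
  congr 1
  refine Finset.sum_congr rfl fun j _ => ?_
  congr 2
  -- Substituting `v = u - j` exposes the circulant entry `a (u - j)`.
  rw [← Equiv.sum_comp (Equiv.addRight (-Fin.castLE hkd j))]
  simp [partialCirculant, signDiagonal, Matrix.mulVec, dotProduct, Matrix.mul_diagonal,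
    ← sub_eq_add_neg, mul_assoc]

/-- With `L = 28 log n` the two exponentials are at most `n⁻⁷` and `n⁻⁵`, so the total is at most
`4n⁻⁵ + 2n⁻⁴ ≤ 1/4`. -/
lemma sum_failure_bound_le {n d k : ℕ} (hn : 2 ≤ n) (hd : d ≤ n) {ε : ℝ} (hε : 0 < ε)
    (hk : 1120 * ε⁻¹ ^ 2 * Real.log n ^ 2 ≤ k) :
    n * (d * (4 * Real.exp (-(28 * Real.log n / 4)))
      + 2 * Real.exp (-(ε ^ 2 * k / (8 * (28 * Real.log n))))) ≤ 1 / 3 := by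
  have hn2 : (2 : ℝ) ≤ n := by exact_mod_cast hn
  have hn0 : (0 : ℝ) < n := by linarith
  have hlog : 0 < Real.log n := Real.log_pos (by linarith)
  have hpow : ∀ m : ℕ, Real.exp (-(m * Real.log n)) = ((n : ℝ) ^ m)⁻¹ := fun m => by
    rw [Real.exp_neg, Real.exp_nat_mul, Real.exp_log hn0]
  have h1 : Real.exp (-(28 * Real.log n / 4)) = ((n : ℝ) ^ 7)⁻¹ := by
    rw [← hpow]
    congr 1
    push_cast
    ring
  have h2 : Real.exp (-(ε ^ 2 * k / (8 * (28 * Real.log n)))) ≤ ((n : ℝ) ^ 5)⁻¹ := by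
    rw [← hpow, Real.exp_le_exp, neg_le_neg_iff, le_div_iff₀ (by positivity)]
    have := mul_le_mul_of_nonneg_left hk (sq_nonneg ε)
    rw [inv_pow] at this
    field_simp at this
    push_cast
    nlinarith
  have hdn : (d : ℝ) ≤ n := by exact_mod_cast hd
  rw [h1]
  calc _ ≤ (n : ℝ) * (n * (4 * ((n : ℝ) ^ 7)⁻¹) + 2 * ((n : ℝ) ^ 5)⁻¹) := by gcongr
    _ = 4 * ((n : ℝ) ^ 5)⁻¹ + 2 * ((n : ℝ) ^ 4)⁻¹ := by
      field_simp
    _ ≤ 4 * ((2 : ℝ) ^ 5)⁻¹ + 2 * ((2 : ℝ) ^ 4)⁻¹ := by gcongr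
    _ ≤ 1 / 3 := by norm_num

theorem theorem1 :
    ∃ C : ℝ, 0 < C ∧
      ∀ (ε : ℝ), 0 < ε → ε < 1 / 2 →
      ∀ (n d k : ℕ), 2 ≤ n → d ≤ n → ∀ (hkd : k ≤ d),
      C * ε⁻¹ ^ 2 * Real.log (n : ℝ) ^ 2 ≤ (k : ℝ) →
      ∀ (x : Fin n → EuclideanSpace ℂ (Fin d))
        (Ω : Type*) [MeasurableSpace Ω] (P : Measure Ω) [IsProbabilityMeasure P]
        (a : Fin d → Ω → ℂ) (s : Fin d → Ω → ℝ),
      (∀ u, IsComplexGaussian (a u) P) → iIndepFun a P →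
      (∀ u, HasLaw (s u) signLaw P) → iIndepFun s P →
      IndepFun (fun ω u => a u ω) (fun ω u => s u ω) P →
      (2 / 3 : ℝ) ≤ P.real {ω | ∀ j : Fin n,
        (1 - ε) * ‖x j‖ ^ 2 ≤ ‖circulantMap hkd (fun u => a u ω) (fun u => s u ω) (x j)‖ ^ 2 ∧
        ‖circulantMap hkd (fun u => a u ω) (fun u => s u ω) (x j)‖ ^ 2 ≤ (1 + ε) * ‖x j‖ ^ 2} := by
  -- `1120 = 5 · 8 · 28`, which makes `ε²k/(8L) ≥ 5 log n` for `L = 28 log n`.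
  refine ⟨1120, by norm_num, ?_⟩
  intro ε hε hε2 n d k hn hdn hkd hk x Ω _ P _ a s ha haind hs hsind has
  have hlog : 0 < Real.log n := Real.log_pos (by exact_mod_cast hn)
  have hk0 : (0 : ℝ) < k := lt_of_lt_of_le (by positivity) hk
  have : NeZero d := ⟨by
    have : 0 < k := by exact_mod_cast hk0
    omega⟩
  set good := {ω | ∀ j : Fin n,
    (1 - ε) * ‖x j‖ ^ 2 ≤ ‖circulantMap hkd (fun u => a u ω) (fun u => s u ω) (x j)‖ ^ 2 ∧
    ‖circulantMap hkd (fun u => a u ω) (fun u => s u ω) (x j)‖ ^ 2 ≤ (1 + ε) * ‖x j‖ ^ 2}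
  set bad : Fin n → Set Ω := fun j => {ω | ¬ (
    (1 - ε) * ‖x j‖ ^ 2 ≤ ‖circulantMap hkd (fun u => a u ω) (fun u => s u ω) (x j)‖ ^ 2 ∧
    ‖circulantMap hkd (fun u => a u ω) (fun u => s u ω) (x j)‖ ^ 2 ≤ (1 + ε) * ‖x j‖ ^ 2)}
    with hbad
  have hbound : ∀ j, P.real (bad j) ≤ d * (4 * Real.exp (-(28 * Real.log n / 4)))
      + 2 * Real.exp (-(ε ^ 2 * k / (8 * (28 * Real.log n)))) := by
    intro j
    -- The single-vector bound needs `σ = ‖x j‖² > 0`; the zero vector never fails.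
    rcases eq_or_ne (x j) 0 with h0 | h0
    · have : bad j = ∅ := by
        simp [hbad, h0, norm_sq_circulantMap]
      rw [this, measureReal_empty]
      positivity
    · have h := measureReal_randomized_correlation_le ha haind hs hsind has
        (Fin.castLE_injective hkd) (x j) (L := 28 * Real.log n) (ε := ε)
        (EuclideanSpace.norm_sq_eq (x j)).symm (by positivity) (by positivity) hε (by linarith)
      simp only [Fintype.card_fin] at h
      refine (measureReal_mono ?_).trans h
      intro ω hω
      simp only [hbad, Set.mem_ofPred_eq, norm_sq_circulantMap, inv_mul_eq_div] at hω ⊢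
      rw [le_div_iff₀ (by positivity), div_le_iff₀ (by positivity)] at hω
      by_contra! hlt
      rw [abs_lt] at hlt
      exact hω ⟨by linarith [hlt.1], by linarith [hlt.2]⟩
  have hcover : Set.univ ⊆ good ∪ ⋃ j, bad j := by
    intro ω _
    by_cases h : ω ∈ good
    · exact Or.inl h
    · right
      obtain ⟨j, hj⟩ := not_forall.1 h
      exact Set.mem_iUnion.2 ⟨j, hj⟩
  have hunion : P.real (⋃ j, bad j) ≤ 1 / 3 := by
    refine (measureReal_iUnion_fintype_le _).trans
      ((Finset.sum_le_sum fun j _ => hbound j).trans ?_)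
    rw [Finset.sum_const, Finset.card_univ, Fintype.card_fin, nsmul_eq_mul]
    exact sum_failure_bound_le hn hdn hε hk
  have htotal := (measureReal_mono (μ := P) hcover).trans (measureReal_union_le _ _)
  rw [probReal_univ] at htotal
  linarith
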